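/- **Setting (adversarial contextual bandits with abstention).** Let $\mathcal X$ be a finite nonempty set of contexts, and let $K\ge 2$ and $T\ge 0$ be integers. The actions are $[K]\cup\{\square\}$, where $\square$ means abstaining. An (oblivious) adversary fixes in advance a sequence $(x_t,r_t)_{t\in[T]}$ with $x_t\in\mathcal X$ and $r_t\in[-1,1]^K$; put $r_{t,\square}:=0$. On trial $t$ the learner sees $x_t$, selects an action $a_t\in[K]\cup\{\square\}$, and then sees (and receives) the reward $r_{t,a_t}$ only. A learning algorithm is any rule that assigns, to the contexts, selected actions and received rewards of trials $1,\dots,t-1$ together with $x_t$, a probability distribution on $[K]\cup\{\square\}$ from which $a_t$ is drawn. A basis is any set $\mathcal B\subseteq 2^{\mathcal X}$; its members are called basis elements. **Proposition.** There is an absolute constant $c>0$ such that the following holds for all $\mathcal X$, $K\ge2$, $T$ as above, every basis $\mathcal B$, every learning algorithm, every integer $M\ge0$ and every sequence $(B_j)_{j\in[M]}$ of pairwise disjoint nonempty basis elements. There are actions $(b_j)_{j\in[M]}$ in $[K]$ and a sequence $(x_t,r_t)_{t\in[T]}\in(\mathcal X\times[-1,1]^K)^T$ such that $$\sum_{t\in[T]}\sum_{j\in[M]}\mathbf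 1[x_t\in B_j]\,r_{t,b_j}-\sum_{t\in[T]}\mathbb E[r_{t,a_t}]\;\ge\;c\,\min\bigl\{T,\sqrt{MKT}\bigr\},$$ where the expectation is over the randomness of the algorithm. In particular the regret is at least $c\sqrt{MKT}$ whenever $T\ge MK$. -/

import Mathlib

noncomputable section

namespace BanditAbstention

/-- The action set `[K] ∪ {□}`: `some k` is the action `k`, and `none` is the abstention action. -/
abbrev Action (K : ℕ) : Type := Option (Fin K)

/-- The reward of an action, given the reward vector of the trial; abstaining has reward `0`. -/
def reward {K : ℕ} (ρ : Fin K → ℝ) : Action K → ℝ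
  | some k => ρ k
  | none => 0

/-- A (randomised) learning algorithm for contextual bandits with abstention. On the trial that is
preceded by `t` others, it sees for each earlier trial the context, the action that it selected and
the reward of that action only, and then the current context; it answers with a probability
distribution over the actions, from which the action of the trial is drawn. -/
def LearningAlgorithm (X : Type*) (K : ℕ) : Type _ :=
  (t : ℕ) → (Fin t → X × Action K × ℝ) → X → PMF (Action K)

/-- What the learner has observed after the trials with contexts `x` and reward vectors `r`, when
it has selected the actions `a`. -/
def observations {X : Type*} {K n : ℕ} (x : Fin n → X) (r : Fin n → Fin K → ℝ)
    (a : Fin n → Action K) : Fin n → X × Action K × ℝ :=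
  fun t => (x t, a t, reward (r t) (a t))

/-- The joint law of the actions `(a_t)` that the algorithm selects when it is run on the sequence
of contexts `x` and reward vectors `r`, both fixed in advance. -/
def actionLaw {X : Type*} {K : ℕ} (A : LearningAlgorithm X K) :
    (n : ℕ) → (Fin n → X) → (Fin n → Fin K → ℝ) → PMF (Fin n → Action K)
  | 0, _, _ => PMF.pure Fin.elim0
  | n + 1, x, r =>
      (actionLaw A n (Fin.init x) (Fin.init r)).bind fun a =>
        (A n (observations (Fin.init x) (Fin.init r) a) (x (Fin.last n))).map
          fun k => Fin.snoc (α := fun _ => Action K) a k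

/-- The expected cumulative reward `∑_t 𝔼[r_{t,a_t}]` of the algorithm. -/
def expectedReward {X : Type*} {K T : ℕ} (A : LearningAlgorithm X K)
    (x : Fin T → X) (r : Fin T → Fin K → ℝ) : ℝ :=
  ∑ t : Fin T, ∑ a : Fin T → Action K, (actionLaw A T x r a).toReal * reward (r t) (a t)

/-- The cumulative reward `∑_t ∑_j 𝟙[x_t ∈ B_j] r_{t,b_j}` of the policy induced by the sets `B`
and the actions `b`: it plays `b j` on `B j` and abstains outside the union of the sets. -/
def policyReward {X : Type*} {K M T : ℕ} (B : Fin M → Set X) (b : Fin M → Fin K)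
    (x : Fin T → X) (r : Fin T → Fin K → ℝ) : ℝ :=
  ∑ t : Fin T, ∑ j : Fin M, (B j).indicator (fun _ => r t (b j)) (x t)

end BanditAbstention

end

noncomputable section

namespace BanditAbstention

/-! Probabilistic method. Fix one context in each `B j` and visit the sets in round-robin order, so
that each is met at most T/M + 1 times. In every set one hidden action gets a random sign of mean ε;
all other actions have mean 0. The policy playing the hidden actions earns Tε on average, while the
learner earns ε times the number of its pulls of hidden actions (`obsExp_sum_reward`). Abstention
earns nothing and reveals nothing, so it cannot help.

It remains to see that, for hidden actions chosen uniformly, at most 3/4 of the trials pull them. If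
no action is favoured in set j, the average of the pull counts over the K actions is at most N/K,
where N is the number of visits. Favouring one action changes the law of the observations by a
likelihood ratio whose expected negative logarithm is at most ε² times the pulls of that action
(`obsExp_log_likelihood`), so its count rises little while ε²N is at most K/72 (`obsExp_pulls_le`,
`sum_obsExp_pulls_le`). The regret is then at least Tε/4 on average, hence for some hidden actions
and some fixed reward table; ε of order min(1, √(MK/T)) is admissible. -/

/-- The expectation of `G` over a reward vector with two independent random signs: the action `g`
(if there is one) receives a sign of mean `ε`, and all the others a common sign of mean `0`. -/
def vectorExp {K : ℕ} (ε : ℝ) (g : Option (Fin K)) (G : (Fin K → ℝ) → ℝ) : ℝ :=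
  ((1 + ε) * (G (fun k => if g = some k then 1 else 1) + G (fun k => if g = some k then 1 else -1))
    + (1 - ε) * (G (fun k => if g = some k then -1 else 1)
        + G (fun k => if g = some k then -1 else -1))) / 4

/-- The expectation of `G` over a table of independent reward vectors distributed as in `vectorExp`,
where the favoured action on trial `t` is `g t`. -/
def tableExp {K : ℕ} (ε : ℝ) (g : ℕ → Option (Fin K)) :
    (n : ℕ) → ((Fin n → Fin K → ℝ) → ℝ) → ℝ
  | 0, G => G Fin.elim0
  | n + 1, G => tableExp ε g n fun r =>
      vectorExp ε (g n) fun ρ => G (Fin.snoc (α := fun _ => Fin K → ℝ) r ρ)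

/-- The expectation of `f` at the reward of the action `k`, when the favoured action is `g`. -/
def rewardExp {K : ℕ} (ε : ℝ) (g : Option (Fin K)) (k : Action K) (f : ℝ → ℝ) : ℝ :=
  if k = none then f 0
  else if g = k then ((1 + ε) * f 1 + (1 - ε) * f (-1)) / 2 else (f 1 + f (-1)) / 2

/-- The expectation of `F` at the observations of the algorithm `A` on the contexts `x` after `n`
trials, when the reward vectors are distributed as in `tableExp`. -/
def obsExp {X : Type*} {K : ℕ} (A : LearningAlgorithm X K) (x : ℕ → X) (ε : ℝ)
    (g : ℕ → Option (Fin K)) : (n : ℕ) → ((Fin n → X × Action K × ℝ) → ℝ) → ℝ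
  | 0, F => F Fin.elim0
  | n + 1, F => obsExp A x ε g n fun h =>
      ∑ k, (A n h (x n) k).toReal *
        rewardExp ε (g n) k fun y => F (Fin.snoc (α := fun _ => X × Action K × ℝ) h (x n, k, y))

/-! ### Reward tables -/

section Tables

variable {K : ℕ} {ε : ℝ} {g : ℕ → Option (Fin K)}

/-- Only one coordinate is ever observed, so the common sign of the unfavoured actions is invisible
to the learner: marginals suffice. -/
theorem vectorExp_reward (g : Option (Fin K)) (k : Action K) (f : ℝ → ℝ) :
    vectorExp ε g (fun ρ => f (reward ρ k)) = rewardExp ε g k f := by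
  cases k with
  | none => simp [vectorExp, rewardExp, reward]; ring
  | some k =>
    by_cases h : g = some k
    · simp [vectorExp, rewardExp, reward, h]; ring
    · simp [vectorExp, rewardExp, reward, h]; ring

theorem vectorExp_mul_left (g : Option (Fin K)) (c : ℝ) (G : (Fin K → ℝ) → ℝ) :
    vectorExp ε g (fun ρ => c * G ρ) = c * vectorExp ε g G := by
  simp only [vectorExp]; ring

theorem vectorExp_sum {ι : Type*} (s : Finset ι) (g : Option (Fin K))
    (G : ι → (Fin K → ℝ) → ℝ) :
    vectorExp ε g (fun ρ => ∑ i ∈ s, G i ρ) = ∑ i ∈ s, vectorExp ε g (G i) := by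
  simp only [vectorExp, ← Finset.sum_add_distrib, Finset.mul_sum, Finset.sum_div]

theorem tableExp_sub (n : ℕ) (G H : (Fin n → Fin K → ℝ) → ℝ) :
    tableExp ε g n (fun r => G r - H r) = tableExp ε g n G - tableExp ε g n H := by
  induction n with
  | zero => rfl
  | succ n ih =>
    simp only [tableExp]
    rw [← ih]
    congr 1; funext r; simp only [vectorExp]; ring

theorem tableExp_add (n : ℕ) (G H : (Fin n → Fin K → ℝ) → ℝ) :
    tableExp ε g n (fun r => G r + H r) = tableExp ε g n G + tableExp ε g n H := by
  induction n with
  | zero => rfl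
  | succ n ih =>
    simp only [tableExp]
    rw [← ih]
    congr 1; funext r; simp only [vectorExp]; ring

theorem tableExp_const (n : ℕ) (c : ℝ) : tableExp ε g n (fun _ => c) = c := by
  induction n with
  | zero => rfl
  | succ n ih =>
    simp only [tableExp]
    rw [show (fun _ : Fin n → Fin K → ℝ => vectorExp ε (g n) fun _ => c) = fun _ => c by
      funext r; simp only [vectorExp]; ring, ih]

/-- A function of the reward table is somewhere at least its mean. -/
theorem exists_tableExp_le (h0 : 0 ≤ ε) (h1 : ε ≤ 1) (n : ℕ) (G : (Fin n → Fin K → ℝ) → ℝ) :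
    ∃ r : Fin n → Fin K → ℝ, (∀ t k, r t k ∈ Set.Icc (-1 : ℝ) 1) ∧ tableExp ε g n G ≤ G r := by
  induction n with
  | zero => exact ⟨Fin.elim0, fun t => t.elim0, le_rfl⟩
  | succ n ih =>
    obtain ⟨r, hr, hG⟩ := ih fun r =>
      vectorExp ε (g n) fun ρ => G (Fin.snoc (α := fun _ => Fin K → ℝ) r ρ)
    suffices h : ∃ ρ : Fin K → ℝ, (∀ k, ρ k ∈ Set.Icc (-1 : ℝ) 1) ∧
        vectorExp ε (g n) (fun ρ => G (Fin.snoc (α := fun _ => Fin K → ℝ) r ρ)) ≤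
          G (Fin.snoc (α := fun _ => Fin K → ℝ) r ρ) by
      obtain ⟨ρ, hρ, h⟩ := h
      refine ⟨Fin.snoc (α := fun _ => Fin K → ℝ) r ρ, fun t => ?_, hG.trans h⟩
      induction t using Fin.lastCases with
      | last => simpa using hρ
      | cast t => simpa using hr t
    by_contra! hlt
    have key : ∀ u v : ℝ, u ∈ Set.Icc (-1 : ℝ) 1 → v ∈ Set.Icc (-1 : ℝ) 1 → _ :=
      fun u v hu hv => hlt (fun k => if g n = some k then u else v)
        fun k => by split_ifs <;> assumption
    have hp : (1 : ℝ) ∈ Set.Icc (-1 : ℝ) 1 := by norm_num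
    have hm : (-1 : ℝ) ∈ Set.Icc (-1 : ℝ) 1 := by norm_num
    have a := key 1 1 hp hp
    have b := key 1 (-1) hp hm
    have c := key (-1) 1 hm hp
    have d := key (-1) (-1) hm hm
    set V := vectorExp ε (g n) fun ρ => G (Fin.snoc (α := fun _ => Fin K → ℝ) r ρ) with hV
    simp only [vectorExp] at hV
    -- The weight 1 - ε may vanish, so strictness has to come from the two terms of weight 1 + ε.
    nlinarith [mul_le_mul_of_nonneg_left (add_lt_add c d).le (sub_nonneg.2 h1),
      mul_lt_mul_of_pos_left (add_lt_add a b) (show 0 < 1 + ε by linarith)]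

theorem tableExp_sum_favoured (g : ℕ → Fin K) (n : ℕ) :
    tableExp ε (fun t => some (g t)) n (fun r => ∑ t : Fin n, r t (g t)) = n * ε := by
  induction n with
  | zero => simp [tableExp]
  | succ n ih =>
    have h : ∀ r : Fin n → Fin K → ℝ, (vectorExp ε (some (g n)) fun ρ =>
        ∑ t : Fin (n + 1), Fin.snoc (α := fun _ => Fin K → ℝ) r ρ t (g t)) =
        (∑ t : Fin n, r t (g t)) + ε := by
      intro r
      simp [vectorExp, Fin.sum_univ_castSucc]; ring
    simp only [tableExp, h]
    rw [tableExp_add, ih, tableExp_const]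
    push_cast; ring

end Tables

/-! ### Observations -/

section Observations

variable {X : Type*} {K : ℕ}

theorem sum_toReal_pmf {α : Type*} [Fintype α] (p : PMF α) : ∑ k, (p k).toReal = 1 := by
  rw [← ENNReal.toReal_sum fun k _ => p.apply_ne_top k, ← tsum_fintype (L := .unconditional _),
    p.tsum_coe, ENNReal.toReal_one]

theorem actionLaw_snoc (A : LearningAlgorithm X K) (n : ℕ) (x : Fin (n + 1) → X)
    (r : Fin (n + 1) → Fin K → ℝ) (a : Fin n → Action K) (k : Action K) :
    actionLaw A (n + 1) x r (Fin.snoc (α := fun _ => Action K) a k) =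
      actionLaw A n (Fin.init x) (Fin.init r) a *
        A n (observations (Fin.init x) (Fin.init r) a) (x (Fin.last n)) k := by
  classical
  have hs : ∀ (a' : Fin n → Action K) (k' : Action K),
      Fin.snoc (α := fun _ => Action K) a k = Fin.snoc (α := fun _ => Action K) a' k' ↔
        a = a' ∧ k = k' := fun a' k' => Fin.snoc_inj
  simp only [actionLaw, PMF.bind_apply, PMF.map_apply, hs, tsum_fintype]
  rw [Finset.sum_eq_single a]
  · congr 1
    simp
  · intro a' _ h
    simp [h.symm]
  · simp

theorem observations_snoc {n : ℕ} (x : Fin (n + 1) → X) (r : Fin n → Fin K → ℝ) (ρ : Fin K → ℝ)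
    (a : Fin n → Action K) (k : Action K) :
    observations x (Fin.snoc (α := fun _ => Fin K → ℝ) r ρ)
        (Fin.snoc (α := fun _ => Action K) a k) =
      Fin.snoc (α := fun _ => X × Action K × ℝ) (observations (Fin.init x) r a)
        (x (Fin.last n), k, reward ρ k) := by
  funext t
  induction t using Fin.lastCases with
  | last => simp [observations]
  | cast t => simp [observations, Fin.init]

theorem sum_actions_succ {n : ℕ} (f : (Fin (n + 1) → Action K) → ℝ) :
    ∑ a, f a = ∑ a : Fin n → Action K, ∑ k, f (Fin.snoc (α := fun _ => Action K) a k) := by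
  rw [← (Fin.snocEquiv fun _ : Fin (n + 1) => Action K).sum_comp, Fintype.sum_prod_type,
    Finset.sum_comm]
  rfl

/-- Averaging over the reward table an expectation under the law of the actions gives the
expectation over the observations. -/
theorem tableExp_actionLaw (A : LearningAlgorithm X K) (x : ℕ → X) (ε : ℝ)
    (g : ℕ → Option (Fin K)) (n : ℕ) (F : (Fin n → X × Action K × ℝ) → ℝ) :
    tableExp ε g n (fun r => ∑ a, (actionLaw A n (fun t => x t) r a).toReal *
      F (observations (fun t => x t) r a)) = obsExp A x ε g n F := by
  induction n with
  | zero =>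
    simp only [tableExp, obsExp, actionLaw, Fintype.sum_unique]
    rw [PMF.pure_apply, if_pos (Subsingleton.elim _ _), ENNReal.toReal_one, one_mul]
    exact congrArg F (Subsingleton.elim _ _)
  | succ n ih =>
    simp only [tableExp, obsExp]
    rw [← ih]
    congr 1; funext r
    simp only [sum_actions_succ, actionLaw_snoc, observations_snoc, Fin.init_snoc,
      vectorExp_sum, ENNReal.toReal_mul, mul_assoc, vectorExp_mul_left, Finset.mul_sum,
      Fin.val_last]
    refine Finset.sum_congr rfl fun a _ => Finset.sum_congr rfl fun k _ => ?_
    rw [← vectorExp_reward]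
    rfl

variable {A : LearningAlgorithm X K} {x : ℕ → X} {ε : ℝ} {g : ℕ → Option (Fin K)}

theorem rewardExp_add (g : Option (Fin K)) (k : Action K) (f f' : ℝ → ℝ) :
    rewardExp ε g k (fun y => f y + f' y) = rewardExp ε g k f + rewardExp ε g k f' := by
  simp only [rewardExp]; split_ifs <;> ring

theorem rewardExp_mul_left (g : Option (Fin K)) (k : Action K) (c : ℝ) (f : ℝ → ℝ) :
    rewardExp ε g k (fun y => c * f y) = c * rewardExp ε g k f := by
  simp only [rewardExp]; split_ifs <;> ring

theorem rewardExp_const (g : Option (Fin K)) (k : Action K) (c : ℝ) :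
    rewardExp ε g k (fun _ => c) = c := by
  simp only [rewardExp]; split_ifs <;> ring

theorem rewardExp_mono (h0 : 0 ≤ ε) (h1 : ε ≤ 1) (g : Option (Fin K)) (k : Action K)
    {f f' : ℝ → ℝ} (h : ∀ y, f y ≤ f' y) : rewardExp ε g k f ≤ rewardExp ε g k f' := by
  have h1' : 0 ≤ 1 - ε := by linarith
  simp only [rewardExp]
  split_ifs
  · exact h 0
  · have := h 1
    have := h (-1)
    gcongr
  · linarith [h 1, h (-1)]

theorem obsExp_add (n : ℕ) (F G : (Fin n → X × Action K × ℝ) → ℝ) :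
    obsExp A x ε g n (fun h => F h + G h) = obsExp A x ε g n F + obsExp A x ε g n G := by
  induction n with
  | zero => rfl
  | succ n ih =>
    simp only [obsExp, rewardExp_add, mul_add, Finset.sum_add_distrib]
    rw [ih]

theorem obsExp_mul_left (n : ℕ) (c : ℝ) (F : (Fin n → X × Action K × ℝ) → ℝ) :
    obsExp A x ε g n (fun h => c * F h) = c * obsExp A x ε g n F := by
  induction n with
  | zero => rfl
  | succ n ih =>
    simp only [obsExp, rewardExp_mul_left, mul_left_comm _ c, ← Finset.mul_sum]
    rw [ih]

theorem obsExp_const (n : ℕ) (c : ℝ) : obsExp A x ε g n (fun _ => c) = c := by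
  induction n with
  | zero => rfl
  | succ n ih =>
    simp only [obsExp, rewardExp_const, ← Finset.sum_mul, sum_toReal_pmf, one_mul]
    rw [ih]

theorem obsExp_sum {ι : Type*} (s : Finset ι) (n : ℕ)
    (F : ι → (Fin n → X × Action K × ℝ) → ℝ) :
    obsExp A x ε g n (fun h => ∑ i ∈ s, F i h) = ∑ i ∈ s, obsExp A x ε g n (F i) := by
  classical
  induction s using Finset.induction_on with
  | empty => simpa using obsExp_const (A := A) (x := x) (ε := ε) (g := g) n 0
  | insert i s hi ih => simp only [Finset.sum_insert hi, obsExp_add, ih]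

theorem obsExp_mono (h0 : 0 ≤ ε) (h1 : ε ≤ 1) (n : ℕ) {F G : (Fin n → X × Action K × ℝ) → ℝ}
    (h : ∀ o, F o ≤ G o) : obsExp A x ε g n F ≤ obsExp A x ε g n G := by
  induction n with
  | zero => exact h _
  | succ n ih =>
    refine ih fun o => Finset.sum_le_sum fun k _ => ?_
    exact mul_le_mul_of_nonneg_left (rewardExp_mono h0 h1 _ _ fun y => h _) ENNReal.toReal_nonneg

/-- A one-step identity for the increments of an additive functional of the observations. -/
theorem obsExp_succ_add (n : ℕ) (F : (Fin n → X × Action K × ℝ) → ℝ)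
    (f : Action K → ℝ → ℝ) :
    (obsExp A x ε g n fun h => ∑ k, (A n h (x n) k).toReal *
      rewardExp ε (g n) k fun y => F h + f k y) =
    obsExp A x ε g n F + obsExp A x ε g n fun h => ∑ k, (A n h (x n) k).toReal *
      rewardExp ε (g n) k (f k) := by
  rw [← obsExp_add]
  congr 1; funext h
  simp only [rewardExp_add, rewardExp_const, mul_add, Finset.sum_add_distrib, ← Finset.sum_mul,
    sum_toReal_pmf, one_mul]

/-- The number of trials among those satisfying `p` on which the action `a t` is selected. -/
def pulls (p : ℕ → Prop) [DecidablePred p] (a : ℕ → Fin K) {n : ℕ}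
    (h : Fin n → X × Action K × ℝ) : ℝ :=
  ∑ t : Fin n, if p t ∧ (h t).2.1 = some (a t) then 1 else 0

/-- The observed reward has mean `ε` times the number of times that the favoured action is
selected. -/
theorem obsExp_sum_reward (g : ℕ → Fin K) (n : ℕ) :
    obsExp A x ε (fun t => some (g t)) n (fun h => ∑ t : Fin n, (h t).2.2) =
      ε * obsExp A x ε (fun t => some (g t)) n (pulls (fun _ => True) g) := by
  induction n with
  | zero => simp [obsExp, pulls]
  | succ n ih =>
    simp only [obsExp, pulls, Fin.sum_univ_castSucc, Fin.snoc_castSucc, Fin.snoc_last,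
      Fin.val_last, Fin.val_castSucc] at ih ⊢
    rw [obsExp_succ_add n (fun h => ∑ t : Fin n, (h t).2.2) fun _ y => y,
      obsExp_succ_add n _ fun k _ => if True ∧ k = some (g n) then 1 else 0, ih, mul_add]
    congr 1
    rw [← obsExp_mul_left]
    congr 1; funext h
    rw [Finset.mul_sum]
    refine Finset.sum_congr rfl fun k _ => ?_
    simp only [rewardExp]
    by_cases hk : k = none
    · simp [hk]
    · by_cases hg : k = some (g n)
      · simp [hg]; ring
      · simp [hk, hg, Ne.symm hg]

end Observations

/-! ### Change of measure -/

section ChangeOfMeasure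

variable {X : Type*} {K : ℕ}

/-- The likelihood ratio of the observations when on the trials satisfying `p` the action `b`
becomes favoured. -/
def likelihood (ε : ℝ) (p : ℕ → Prop) [DecidablePred p] (b : Fin K) {n : ℕ}
    (h : Fin n → X × Action K × ℝ) : ℝ :=
  ∏ t : Fin n, if p t ∧ (h t).2.1 = some b then (if 0 < (h t).2.2 then 1 + ε else 1 - ε) else 1

variable {A : LearningAlgorithm X K} {x : ℕ → X} {ε : ℝ} {g : ℕ → Option (Fin K)}
  {p : ℕ → Prop} [DecidablePred p] {b : Fin K}

theorem likelihood_pos (h0 : 0 ≤ ε) (h1 : ε < 1) {n : ℕ} (h : Fin n → X × Action K × ℝ) :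
    0 < likelihood ε p b h := by
  refine Finset.prod_pos fun t _ => ?_
  split_ifs <;> linarith

theorem likelihood_snoc {n : ℕ} (h : Fin n → X × Action K × ℝ) (z : X) (k : Action K) (y : ℝ) :
    likelihood ε p b (Fin.snoc (α := fun _ => X × Action K × ℝ) h (z, k, y)) =
      likelihood ε p b h *
        if p n ∧ k = some b then (if 0 < y then 1 + ε else 1 - ε) else 1 := by
  simp [likelihood, Fin.prod_univ_castSucc]

/-- On the trials in `p` the base law makes the sign of `b` fair, so favouring `b` multiplies the
probability of an observed sign by 1 ± ε; observations of other actions and abstentions keep their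
law. -/
theorem obsExp_change (hg : ∀ t, p t → g t = none) (n : ℕ)
    (F : (Fin n → X × Action K × ℝ) → ℝ) :
    obsExp A x ε (fun t => if p t then some b else g t) n F =
      obsExp A x ε g n (fun h => likelihood ε p b h * F h) := by
  induction n with
  | zero => simp [obsExp, likelihood]
  | succ n ih =>
    simp only [obsExp]
    rw [ih]
    congr 1; funext h
    rw [Finset.mul_sum]
    refine Finset.sum_congr rfl fun k _ => ?_
    simp only [likelihood_snoc]
    rw [mul_left_comm]
    congr 1
    by_cases hp : p n
    · simp only [rewardExp, hp, hg n hp, true_and, if_true]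
      rcases eq_or_ne k none with rfl | hk
      · simp
      · by_cases hb : k = some b
        · subst hb
          simp
          norm_num
          ring
        · simp [hk, hb, Ne.symm hk, Ne.symm hb]; ring
    · simp only [rewardExp, hp, false_and, if_false]
      split_ifs <;> ring

/-- Chain rule for relative entropy: only pulls of `b` in `p` contribute, each by -log(1 - ε²)/2 ≤
ε². -/
theorem obsExp_log_likelihood (h0 : 0 ≤ ε) (h1 : ε ≤ 1 / 2) (hg : ∀ t, p t → g t = none)
    (n : ℕ) :
    -obsExp A x ε g n (fun h => Real.log (likelihood ε p b h)) ≤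
      ε ^ 2 * obsExp A x ε g n (pulls p fun _ => b) := by
  have hlog : -(2 * ε ^ 2) ≤ Real.log (1 + ε) + Real.log (1 - ε) := by
    rw [← Real.log_mul (by linarith) (by linarith)]
    have hpos : 0 < (1 + ε) * (1 - ε) := by nlinarith
    have := Real.one_sub_inv_le_log_of_pos hpos
    have h2 : ((1 + ε) * (1 - ε))⁻¹ ≤ 1 + 2 * ε ^ 2 := by
      rw [inv_le_iff_one_le_mul₀ hpos]
      nlinarith [sq_nonneg ε, mul_nonneg (sq_nonneg ε) (show 0 ≤ 1 - 2 * ε ^ 2 by nlinarith)]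
    linarith
  induction n with
  | zero => simp [obsExp, likelihood, pulls]
  | succ n ih =>
    have hL : ∀ (h : Fin n → X × Action K × ℝ) (k : Action K) (y : ℝ),
        Real.log (likelihood ε p b (Fin.snoc (α := fun _ => X × Action K × ℝ) h (x n, k, y))) =
        Real.log (likelihood ε p b h) + Real.log
          (if p n ∧ k = some b then (if 0 < y then 1 + ε else 1 - ε) else 1) := by
      intro h k y
      rw [likelihood_snoc, Real.log_mul (likelihood_pos h0 (by linarith) h).ne']
      split_ifs <;> linarith
    simp only [obsExp, hL]
    simp only [pulls, Fin.sum_univ_castSucc, Fin.snoc_castSucc, Fin.snoc_last,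
      Fin.val_last, Fin.val_castSucc] at ih ⊢
    rw [obsExp_succ_add n _ fun k y => Real.log
        (if p n ∧ k = some b then (if 0 < y then 1 + ε else 1 - ε) else 1),
      obsExp_succ_add n _ fun k _ => if p n ∧ k = some b then 1 else 0, neg_add, mul_add]
    refine add_le_add ih ?_
    rw [neg_le_iff_add_nonneg, ← obsExp_mul_left, ← obsExp_add]
    refine (obsExp_const (A := A) (x := x) (ε := ε) (g := g) n 0).ge.trans
      (obsExp_mono h0 (by linarith) n fun h => ?_)
    rw [Finset.mul_sum, ← Finset.sum_add_distrib]
    refine Finset.sum_nonneg fun k _ => ?_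
    rw [mul_left_comm, ← mul_add]
    refine mul_nonneg ENNReal.toReal_nonneg ?_
    rw [rewardExp_const]
    by_cases hk : p n ∧ k = some b
    · obtain ⟨hp, rfl⟩ := hk
      simp only [rewardExp, hp, hg n hp]
      simp
      norm_num
      linarith
    · simp [hk, rewardExp_const]

theorem pulls_nonneg (a : ℕ → Fin K) {n : ℕ} (h : Fin n → X × Action K × ℝ) :
    0 ≤ pulls p a h :=
  Finset.sum_nonneg fun t _ => by split_ifs <;> norm_num

theorem pulls_le (a : ℕ → Fin K) {n : ℕ} (h : Fin n → X × Action K × ℝ) :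
    pulls p a h ≤ ∑ t : Fin n, if p t then 1 else 0 :=
  Finset.sum_le_sum fun t _ => by split_ifs <;> simp_all

/-- Each trial selects at most one action. -/
theorem sum_pulls_le {n : ℕ} (h : Fin n → X × Action K × ℝ) :
    ∑ k, pulls p (fun _ => k) h ≤ ∑ t : Fin n, if p t then 1 else 0 := by
  simp only [pulls]
  rw [Finset.sum_comm]
  refine Finset.sum_le_sum fun t _ => ?_
  by_cases hp : p t
  · simp only [hp, true_and, if_true]
    cases h' : (h t).2.1 with
    | none => simp
    | some k => simp
  · simp [hp]

/-- Tangent line of the logarithm at 9/8, with log(9/8) ≤ 1/8. This linear bound plays the role of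
Pinsker's inequality. -/
theorem sub_one_le_log_bound {L : ℝ} (hL : 0 < L) :
    L - 1 ≤ 1 / 8 + 9 * (L - 1 - Real.log L) := by
  have h1 := Real.log_le_sub_one_of_pos (show 0 < L * (8 / 9) by positivity)
  have h2 := Real.log_le_sub_one_of_pos (show (0 : ℝ) < 9 / 8 by norm_num)
  have h3 : Real.log L = Real.log (L * (8 / 9)) + Real.log (9 / 8) := by
    rw [← Real.log_mul (by positivity) (by norm_num)]
    congr 1; ring
  linarith

/-- Favouring an action on some trials does not make the algorithm select it there much more
often. -/
theorem obsExp_pulls_le (h0 : 0 ≤ ε) (h1 : ε ≤ 1 / 2) (hg : ∀ t, p t → g t = none) (n : ℕ)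
    {N : ℝ} (hN : N = ∑ t : Fin n, if p t then 1 else 0) :
    obsExp A x ε (fun t => if p t then some b else g t) n (pulls p fun _ => b) ≤
      (1 + 9 * N * ε ^ 2) * obsExp A x ε g n (pulls p fun _ => b) + N / 8 := by
  have hN0 : 0 ≤ N := hN ▸ Finset.sum_nonneg fun t _ => by split_ifs <;> norm_num
  have hone : obsExp A x ε g n (likelihood ε p b) = 1 := by
    have := obsExp_change (A := A) (x := x) (ε := ε) (b := b) hg n fun _ => 1
    rw [obsExp_const] at this
    simpa using this.symm
  have hlog := obsExp_log_likelihood (A := A) (x := x) (b := b) h0 h1 hg n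
  rw [obsExp_change hg]
  -- As E[L] = 1, the expectation of this pointwise bound leaves E[P] + N/8 + 9N·E[-log L].
  have key : ∀ h : Fin n → X × Action K × ℝ,
      likelihood ε p b h * pulls p (fun _ => b) h ≤
        (pulls p (fun _ => b) h + (N / 8 - 9 * N)) +
          (9 * N * likelihood ε p b h + (-(9 * N)) * Real.log (likelihood ε p b h)) := by
    intro h
    have hL := likelihood_pos (p := p) (b := b) h0 (by linarith) h
    have hP0 := pulls_nonneg (p := p) (fun _ => b) h
    have hPN : pulls p (fun _ => b) h ≤ N := hN ▸ pulls_le (p := p) (fun _ => b) h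
    have hφ := sub_one_le_log_bound hL
    have hφ0 := Real.log_le_sub_one_of_pos hL
    set L := likelihood ε p b h
    set P := pulls p (fun _ => b) h
    have h1 : P * (L - 1) ≤ P * (1 / 8 + 9 * (L - 1 - Real.log L)) :=
      mul_le_mul_of_nonneg_left hφ hP0
    have h2 : P * (1 / 8 + 9 * (L - 1 - Real.log L)) ≤ N * (1 / 8 + 9 * (L - 1 - Real.log L)) :=
      mul_le_mul_of_nonneg_right hPN (by linarith)
    linarith
  refine (obsExp_mono h0 (by linarith) n key).trans ?_
  rw [obsExp_add, obsExp_add, obsExp_add, obsExp_const, obsExp_mul_left, obsExp_mul_left]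
  have hone' : obsExp A x ε g n (fun h => likelihood ε p b h) = 1 := hone
  have hη : obsExp A x ε g n (fun h => pulls p (fun _ => b) h) =
    obsExp A x ε g n (pulls p fun _ => b) := rfl
  rw [hone', hη]
  have := mul_le_mul_of_nonneg_left hlog (show 0 ≤ 9 * N by positivity)
  linarith

end ChangeOfMeasure

/-! ### Averaging over the favoured actions -/

section Averaging

variable {X : Type*} {K M : ℕ}

/-- Resampling a coordinate leaves the average over all functions unchanged. -/
theorem sum_apply_coordinate (hK : 0 < K) (j : Fin M) (Φ : (Fin M → Fin K) → Fin K → ℝ)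
    (hΦ : ∀ b c, (∀ i, i ≠ j → b i = c i) → Φ b = Φ c) :
    K * ∑ b, Φ b (b j) = ∑ b, ∑ k, Φ b k := by
  have : NeZero K := ⟨hK.ne'⟩
  have h1 : ∀ k : Fin K, ∑ b : Fin M → Fin K, Φ b (b j + k) = ∑ b, Φ b (b j) := by
    intro k
    -- Translating coordinate `j` by `k` modulo K permutes the functions `b` and does not change `Φ
    -- b`.
    rw [← Equiv.sum_comp (Equiv.addRight (Pi.single j k : Fin M → Fin K)) fun b => Φ b (b j)]
    refine Finset.sum_congr rfl fun b _ => ?_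
    rw [hΦ b (Equiv.addRight (Pi.single j k) b) fun i hi => by simp [hi]]
    simp
  calc K * ∑ b, Φ b (b j) = ∑ k : Fin K, ∑ b : Fin M → Fin K, Φ b (b j + k) := by simp [h1]
    _ = ∑ b, ∑ k, Φ b (b j + k) := Finset.sum_comm
    _ = ∑ b, ∑ k, Φ b k := Finset.sum_congr rfl fun b _ =>
        Equiv.sum_comp (Equiv.addLeft (b j)) fun k => Φ b k

/-- With set `j` made neutral, the law does not depend on `b j`, so a uniform `b j` is pulled at
most N/K times on average; the change of measure then gives (5K/8)(N/K) + N/8 = 3N/4. -/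
theorem sum_obsExp_pulls_le (A : LearningAlgorithm X K) (x : ℕ → X) {ε : ℝ} (h0 : 0 ≤ ε)
    (h1 : ε ≤ 1 / 2) (hK : 2 ≤ K) (idx : ℕ → Fin M) (j : Fin M) (n : ℕ) {N : ℝ}
    (hN : N = ∑ t : Fin n, if idx t = j then 1 else 0) (hε : 72 * (ε ^ 2 * N) ≤ K) :
    ∑ b : Fin M → Fin K, obsExp A x ε (fun t => some (b (idx t))) n
        (pulls (fun t => idx t = j) fun _ => b j) ≤
      (K : ℝ) ^ M * (3 / 4 * N) := by
  have hN0 : 0 ≤ N := hN ▸ Finset.sum_nonneg fun t _ => by split_ifs <;> norm_num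
  have hK' : (2 : ℝ) ≤ K := by exact_mod_cast hK
  let base : (Fin M → Fin K) → ℕ → Option (Fin K) :=
    fun b t => if idx t = j then none else some (b (idx t))
  let Φ : (Fin M → Fin K) → Fin K → ℝ :=
    fun b k => obsExp A x ε (base b) n (pulls (fun t => idx t = j) fun _ => k)
  have hstep : ∀ b : Fin M → Fin K, obsExp A x ε (fun t => some (b (idx t))) n
      (pulls (fun t => idx t = j) fun _ => b j) ≤ (1 + 9 * N * ε ^ 2) * Φ b (b j) + N / 8 := by
    intro b
    have hb : (fun t => some (b (idx t))) =
        fun t => if idx t = j then some (b j) else base b t := by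
      funext t
      by_cases h : idx t = j <;> simp [base, h]
    rw [hb]
    exact obsExp_pulls_le h0 h1 (fun t ht => by simp [base, ht]) n hN
  have havg : K * ∑ b, Φ b (b j) ≤ (K : ℝ) ^ M * N := by
    rw [sum_apply_coordinate (by omega) j Φ]
    · have : ∀ b, ∑ k, Φ b k ≤ N := by
        intro b
        rw [← obsExp_sum, ← obsExp_const (A := A) (x := x) (ε := ε) (g := base b) n N]
        exact obsExp_mono h0 (by linarith) n fun h => hN ▸ sum_pulls_le h
      refine (Finset.sum_le_sum fun b _ => this b).trans ?_
      simp
    · intro b c hbc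
      have : base b = base c := by
        funext t
        by_cases h : idx t = j
        · simp [base, h]
        · simp [base, h, hbc _ h]
      simp only [Φ, this]
  refine (Finset.sum_le_sum fun b _ => hstep b).trans ?_
  rw [Finset.sum_add_distrib, ← Finset.mul_sum]
  simp only [Finset.sum_const, Finset.card_univ, Fintype.card_fun, Fintype.card_fin, nsmul_eq_mul,
    Nat.cast_pow]
  set S := ∑ b, Φ b (b j)
  set Q : ℝ := (K : ℝ) ^ M
  have hQ : 0 ≤ Q := by positivity
  -- Here 9Nε² ≤ K/8 by `hε`, and 1 ≤ K/2 because K ≥ 2.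
  have hcoef : 1 + 9 * N * ε ^ 2 ≤ K * (5 / 8) := by nlinarith
  have hS0 : 0 ≤ S := Finset.sum_nonneg fun b _ => by
    rw [← obsExp_const (A := A) (x := x) (ε := ε) (g := base b) n 0]
    exact obsExp_mono h0 (by linarith) n fun h => pulls_nonneg _ h
  have := mul_le_mul_of_nonneg_right hcoef hS0
  linarith

theorem pulls_eq_sum (idx : ℕ → Fin M) (b : Fin M → Fin K) {n : ℕ}
    (h : Fin n → X × Action K × ℝ) :
    pulls (fun _ => True) (fun t => b (idx t)) h =
      ∑ j, pulls (fun t => idx t = j) (fun _ => b j) h := by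
  simp only [pulls]
  rw [Finset.sum_comm]
  refine Finset.sum_congr rfl fun t _ => ?_
  rw [Finset.sum_eq_single (idx t)]
  · simp
  · intro j _ hj
    simp [hj.symm]
  · simp

/-- The regret of the algorithm against some choice of the favoured actions. -/
theorem exists_regret_ge (A : LearningAlgorithm X K) (x : ℕ → X) {ε : ℝ} (h0 : 0 ≤ ε)
    (h1 : ε ≤ 1 / 2) (hK : 2 ≤ K) (idx : ℕ → Fin M) (n : ℕ)
    (hε : ∀ j, 72 * (ε ^ 2 * ∑ t : Fin n, if idx t = j then 1 else 0) ≤ K) :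
    ∃ (b : Fin M → Fin K) (r : Fin n → Fin K → ℝ), (∀ t k, r t k ∈ Set.Icc (-1 : ℝ) 1) ∧
      n * ε / 4 ≤ (∑ t : Fin n, r t (b (idx t))) - expectedReward A (fun t => x t) r := by
  have hQ : (0 : ℝ) < (K : ℝ) ^ M := by
    have : (0 : ℝ) < K := by exact_mod_cast (by omega : 0 < K)
    positivity
  have hreg : ∀ b : Fin M → Fin K, tableExp ε (fun t => some (b (idx t))) n
      (fun r => (∑ t : Fin n, r t (b (idx t))) - expectedReward A (fun t => x t) r) =
      n * ε - ε * ∑ j, obsExp A x ε (fun t => some (b (idx t))) n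
        (pulls (fun t => idx t = j) fun _ => b j) := by
    intro b
    rw [tableExp_sub, tableExp_sum_favoured fun t => b (idx t), ← obsExp_sum]
    congr 1
    have hF : ∀ r : Fin n → Fin K → ℝ, expectedReward A (fun t => x t) r =
        ∑ a, (actionLaw A n (fun t => x t) r a).toReal *
          ∑ t : Fin n, (observations (fun t : Fin n => x t) r a t).2.2 := by
      intro r
      rw [expectedReward, Finset.sum_comm]
      simp only [Finset.mul_sum]
      rfl
    rw [funext hF]
    rw [tableExp_actionLaw A x ε _ n fun h => ∑ t : Fin n, (h t).2.2,
      obsExp_sum_reward fun t => b (idx t)]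
    congr 2; funext h
    exact pulls_eq_sum idx b h
  have hcount : ∑ j, ∑ t : Fin n, (if idx t = j then (1 : ℝ) else 0) = n := by
    rw [Finset.sum_comm]
    simp
  have hsum : ∑ b : Fin M → Fin K, ∑ j, obsExp A x ε (fun t => some (b (idx t))) n
      (pulls (fun t => idx t = j) fun _ => b j) ≤ (K : ℝ) ^ M * (3 / 4 * n) := by
    rw [Finset.sum_comm, ← hcount, Finset.mul_sum, Finset.mul_sum]
    exact Finset.sum_le_sum fun j _ => sum_obsExp_pulls_le A x h0 h1 hK idx j n rfl (hε j)
  obtain ⟨b, -, hb⟩ : ∃ b ∈ (Finset.univ : Finset (Fin M → Fin K)), n * ε / 4 ≤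
      tableExp ε (fun t => some (b (idx t))) n
        (fun r => (∑ t : Fin n, r t (b (idx t))) - expectedReward A (fun t => x t) r) := by
    refine Finset.exists_le_of_sum_le ?_ ?_
    · have : Nonempty (Fin K) := ⟨⟨0, by omega⟩⟩
      exact Finset.univ_nonempty
    · simp only [hreg, Finset.sum_sub_distrib, ← Finset.mul_sum, Finset.sum_const,
        Finset.card_univ, Fintype.card_fun, Fintype.card_fin, nsmul_eq_mul, Nat.cast_pow]
      nlinarith [mul_le_mul_of_nonneg_left hsum h0]
  obtain ⟨r, hr, h⟩ := exists_tableExp_le (g := fun t => some (b (idx t))) h0 (by linarith) n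
    fun r => (∑ t : Fin n, r t (b (idx t))) - expectedReward A (fun t => x t) r
  exact ⟨b, r, hr, hb.trans h⟩

end Averaging

/-! ### Round-robin contexts and the choice of the bias -/

theorem policyReward_of_mem {X : Type*} {K M T : ℕ} {B : Fin M → Set X}
    (hB : Pairwise (Function.onFun Disjoint B)) (b : Fin M → Fin K) (x : Fin T → X)
    (r : Fin T → Fin K → ℝ) (idx : Fin T → Fin M) (hx : ∀ t, x t ∈ B (idx t)) :
    policyReward B b x r = ∑ t, r t (b (idx t)) := by
  refine Finset.sum_congr rfl fun t _ => ?_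
  rw [Finset.sum_eq_single (idx t)]
  · simp [hx t]
  · intro j _ hj
    exact Set.indicator_of_notMem (fun h => Set.disjoint_left.1 (hB hj) h (hx t)) _
  · simp

theorem sum_ofNat_eq_le (M n : ℕ) [NeZero M] (j : Fin M) :
    (∑ t : Fin n, if Fin.ofNat M t = j then (1 : ℝ) else 0) ≤ n / M + 1 := by
  have hM : 0 < M := Nat.pos_of_neZero M
  have h : (∑ t : Fin n, if Fin.ofNat M t = j then (1 : ℝ) else 0) =
      (n.count (· ≡ j [MOD M]) : ℕ) := by
    rw [Fin.sum_univ_eq_sum_range fun t => if Fin.ofNat M t = j then (1 : ℝ) else 0,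
      Nat.count_eq_card_filter_range, Finset.card_filter]
    push_cast
    refine Finset.sum_congr rfl fun t _ => ?_
    congr 1
    simp [Fin.ext_iff, Nat.ModEq, Nat.mod_eq_of_lt j.2]
  rw [h, Nat.count_modEq_card _ hM]
  push_cast
  refine add_le_add Nat.cast_div_le ?_
  split_ifs <;> norm_num

end BanditAbstention

end

theorem mainTheorem4 :
    ∃ c : ℝ, 0 < c ∧
      ∀ (X : Type*) [Finite X] [Nonempty X] (𝓑 : Set (Set X)) (K M T : ℕ), 2 ≤ K →
      ∀ (A : BanditAbstention.LearningAlgorithm X K) (B : Fin M → Set X),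
        (∀ j, B j ∈ 𝓑) → (∀ j, (B j).Nonempty) → Pairwise (Function.onFun Disjoint B) →
      ∃ b : Fin M → Fin K, ∃ (x : Fin T → X) (r : Fin T → Fin K → ℝ),
        (∀ t k, r t k ∈ Set.Icc (-1 : ℝ) 1) ∧
        c * min (T : ℝ) (Real.sqrt ((M : ℝ) * (K : ℝ) * (T : ℝ))) ≤
          BanditAbstention.policyReward B b x r - BanditAbstention.expectedReward A x r := by
  -- The bias is ε = m/(12T), and the regret Tε/4 equals m/48.
  refine ⟨1 / 48, by norm_num, fun X _ _ 𝓑 K M T hK A B _ hne hdisj => ?_⟩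
  rcases Nat.eq_zero_or_pos M with rfl | hM
  · refine ⟨Fin.elim0, fun _ => Classical.arbitrary X, fun _ _ => 0, by simp, ?_⟩
    have h : ∀ a : BanditAbstention.Action K,
        BanditAbstention.reward (fun _ : Fin K => (0 : ℝ)) a = 0 := by
      rintro (_ | k) <;> rfl
    simp [BanditAbstention.policyReward, BanditAbstention.expectedReward, h]
  have : NeZero M := ⟨hM.ne'⟩
  choose z hz using hne
  have hK' : (2 : ℝ) ≤ K := by exact_mod_cast hK
  have hM' : (0 : ℝ) < M := by exact_mod_cast hM
  set m := min (T : ℝ) (Real.sqrt ((M : ℝ) * (K : ℝ) * (T : ℝ))) with hm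
  have hm0 : 0 ≤ m := le_min (by positivity) (by positivity)
  have hmT : m ≤ T := min_le_left _ _
  have hm2 : m ^ 2 ≤ M * K * T := by
    rw [← Real.sq_sqrt (show 0 ≤ (M : ℝ) * K * T by positivity)]
    exact pow_le_pow_left₀ hm0 (min_le_right _ _) 2
  have hε1 : m / (12 * T) ≤ 1 / 12 := by
    rw [mul_comm, ← div_div]
    exact div_le_div_of_nonneg_right (div_le_one_of_le₀ hmT (by positivity)) (by norm_num)
  have hε0 : 0 ≤ m / (12 * T) := by positivity
  obtain ⟨b, r, hr, h⟩ := BanditAbstention.exists_regret_ge A (fun t => z (Fin.ofNat M t)) hε0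
    (by linarith) hK (fun t => Fin.ofNat M t) T fun j => by
      have hc := BanditAbstention.sum_ofNat_eq_le M T j
      have h1 : (m / (12 * T)) ^ 2 * (T / M) ≤ K / 144 := by
        rcases Nat.eq_zero_or_pos T with rfl | hT
        · simp; positivity
        · have hT' : (0 : ℝ) < T := by exact_mod_cast hT
          rw [div_pow, div_mul_div_comm, div_le_div_iff₀ (by positivity) (by norm_num)]
          nlinarith [mul_le_mul_of_nonneg_right hm2 hT'.le]
      have h2 : (m / (12 * T)) ^ 2 ≤ (1 / 12) ^ 2 := pow_le_pow_left₀ hε0 hε1 2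
      have h3 := mul_le_mul_of_nonneg_left hc (sq_nonneg (m / (12 * T)))
      -- 72ε²(T/M + 1) ≤ K/2 + 1/2 ≤ K.
      linarith
  refine ⟨b, fun t => z (Fin.ofNat M t), r, hr, ?_⟩
  rw [BanditAbstention.policyReward_of_mem hdisj b _ r (fun t => Fin.ofNat M t) fun t => hz _]
  refine le_trans (le_of_eq ?_) h
  -- For T = 0 the bias is a division by zero, but both sides vanish.
  rcases Nat.eq_zero_or_pos T with rfl | hT
  · have : m = 0 := le_antisymm (by simpa using hmT) hm0
    simp [this]
  · have hT' : (0 : ℝ) < T := by exact_mod_cast hT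
    field_simp
    ring
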